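/- Let $\mathcal G$ be a finite simple undirected graph with at least two vertices, with vertex set $V$ and edge set $E$. For an oriented edge $e=\overrightarrow{th}$ put $\mathbf x_e=\mathbf 1_h-\mathbf 1_t\in\mathbb R^V$, where $\mathbf 1_u$ $(u\in V)$ are the standard basis vectors. Let $$P_{\mathcal G}=\operatorname{conv}\{\mathbf 1_u-\mathbf 1_w,\ \mathbf 1_w-\mathbf 1_u \mid uw\in E\}$$ be the symmetric edge polytope of $\mathcal G$. An oriented spanning tree of $\mathcal G$ is a spanning tree of $\mathcal G$ each of whose edges is given one of its two orientations; for such a tree $T$ let $\mathcal Q_T=\operatorname{conv}\{\mathbf x_e\mid e\in T\}$. A set $\mathcal T$ of oriented spanning trees of $\mathcal G$ is called a dissecting tree set for $\mathcal G$ if the simplices $\mathcal Q_T$, $T\in\mathcal T$, have pairwise disjoint relative interiors and their union is the relative boundary of $P_{\mathcal G}$ (its boundary within its affine hull). An edge $e\in T$ points away from a vertex $v$ in $T$ if $v$ lies in the component of $T-e$ that contains the tail of $e$. Then for every integer $i\ge 0$ the number $$|\{T\in\mathcal T\mid T\text{ has exactly } i \text{ edges pointing away from } v\}|$$ is the same for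 all dissecting tree sets $\mathcal T$ for $\mathcal G$ and all vertices $v\in V$. That is, if $\mathcal T_1,\mathcal T_2$ are dissecting tree sets for $\mathcal G$ and $v_1,v_2\in V$, then the number for $(\mathcal T_1,v_1)$ equals the number for $(\mathcal T_2,v_2)$. -/

import Mathlib

namespace SimpleGraph

variable {V : Type*} [DecidableEq V] (G : SimpleGraph V)

/-- The vector `1_h - 1_t` in `ℝ^V` of an edge of `G` oriented from its tail `t = e.fst` to its
head `h = e.snd`. A `G.Dart` is an edge of `G` together with an orientation. -/
def edgeVector {G : SimpleGraph V} (e : G.Dart) : V → ℝ :=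
  Pi.single e.snd 1 - Pi.single e.fst 1

/-- The root polytope of a set `T` of oriented edges of `G`. -/
def rootPolytope {G : SimpleGraph V} (T : Set G.Dart) : Set (V → ℝ) :=
  convexHull ℝ (edgeVector '' T)

/-- The symmetric edge polytope of `G`: each edge contributes both of its orientations. -/
def symmetricEdgePolytope : Set (V → ℝ) :=
  convexHull ℝ (Set.range (edgeVector (G := G)))

/-- The undirected graph on all of `V` obtained from a set of oriented edges by forgetting the
orientations. -/
def underlyingGraph {V : Type*} {G : SimpleGraph V} (T : Set G.Dart) : SimpleGraph V :=
  fromEdgeSet (Dart.edge '' T)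

/-- `T` is a spanning tree of `G` in which every edge is given exactly one orientation. -/
def IsOrientedSpanningTree {V : Type*} {G : SimpleGraph V} (T : Set G.Dart) : Prop :=
  (underlyingGraph T).IsTree ∧ ∀ e ∈ T, e.symm ∉ T

/-- A set of oriented spanning trees whose root polytopes dissect the (relative) boundary of the
symmetric edge polytope of `G`: their relative interiors are pairwise disjoint and their union is
the whole boundary. -/
structure IsDissectingTreeSet (𝒯 : Set (Set G.Dart)) : Prop where
  isOrientedSpanningTree : ∀ T ∈ 𝒯, IsOrientedSpanningTree T
  interior_disjoint : ∀ T ∈ 𝒯, ∀ T' ∈ 𝒯, T ≠ T' →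
    Disjoint (intrinsicInterior ℝ (rootPolytope T)) (intrinsicInterior ℝ (rootPolytope T'))
  iUnion_eq : ⋃ T ∈ 𝒯, rootPolytope T = intrinsicFrontier ℝ G.symmetricEdgePolytope

/-- The edges `e` of `T` pointing away from `v`: the vertex `v` lies in the component of `T - e`
that contains the tail of `e`. -/
def edgesPointingAway {V : Type*} {G : SimpleGraph V} (T : Set G.Dart) (v : V) : Set G.Dart :=
  {e | e ∈ T ∧ (underlyingGraph (T \ {e})).Reachable v e.fst}

end SimpleGraph

/-! Count lattice points on dilates of the boundary of the polytope in two ways. The edge vectors of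
an oriented spanning tree `T` form a basis of the lattice of zero-sum integer vectors (a basis over
any ring), and the coordinates are the cut forms. On the cone over the simplex of `T` the gauge of
the polytope is the sum of these coordinates, so the number of integer points of gauge `k` refers
neither to a dissection nor to a vertex.

To distribute these points among the cones without overlap, move each point `z` to `z + 1_v -
(1/n)(1,...,1)`, where `n` is the number of vertices. No cut coordinate of the moved point is an
integer, so it lies in the interior of exactly one cone. For `z` itself this means that the
coordinate of `e` is at least `1` if `e` points away from `v`, and at least `0` otherwise. A tree
with `i` edges pointing away thus receives as many points of gauge `k` as there are ways to write `k
- i` as an ordered sum of `n - 1` natural numbers (`card_halfOpenConePoints`).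

Summing over the trees gives `card_heightPoints`. The resulting system is unitriangular in `k` and
`i`, so its left-hand side determines the number of trees for each `i` (`card_filter_eq_of_sum_eq`).
-/

namespace SimpleGraph

/-! ### Fundamental cuts of an oriented spanning tree -/

section Combinatorics

variable {V : Type*} {G : SimpleGraph V} {T : Set G.Dart}

theorem underlyingGraph_adj {u w : V} :
    (underlyingGraph T).Adj u w ↔ ∃ e ∈ T, (e.fst = u ∧ e.snd = w) ∨ (e.fst = w ∧ e.snd = u) := by
  constructor
  · intro h
    obtain ⟨⟨e, he, hee⟩, -⟩ := (fromEdgeSet_adj _).1 h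
    refine ⟨e, he, ?_⟩
    exact Sym2.eq_iff.1 (hee : s(e.fst, e.snd) = s(u, w))
  · rintro ⟨e, he, h⟩
    have hne : e.fst ≠ e.snd := e.adj.ne
    refine (fromEdgeSet_adj _).2 ⟨⟨e, he, ?_⟩, ?_⟩
    · exact (Sym2.eq_iff.2 h : s(e.fst, e.snd) = s(u, w))
    · rcases h with ⟨rfl, rfl⟩ | ⟨rfl, rfl⟩
      · exact hne
      · exact hne.symm

/-- The vertices in the component of `T - e` that contains the head of `e`. -/
def headSide (T : Set G.Dart) (e : G.Dart) : Set V :=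
  {u | (underlyingGraph (T \ {e})).Reachable e.snd u}

theorem snd_mem_headSide (e : G.Dart) : e.snd ∈ headSide T e := Reachable.refl _

/-- The reverse of `e` is not in `T`, so no other dart of `T` keeps the undirected edge alive. -/
theorem IsOrientedSpanningTree.underlyingGraph_diff (hT : IsOrientedSpanningTree T) {e : G.Dart}
    (he : e ∈ T) : underlyingGraph (T \ {e}) = (underlyingGraph T).deleteEdges {e.edge} := by
  ext u w
  rw [deleteEdges_adj, underlyingGraph_adj, underlyingGraph_adj]
  have key : ∀ f ∈ T, f.edge = e.edge → f = e := by
    intro f hf h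
    rcases dart_edge_eq_iff _ _ |>.1 h with h | h
    · exact h
    · exact absurd (h ▸ hf) (hT.2 e he)
  constructor
  · rintro ⟨f, ⟨hf, hfe⟩, h⟩
    refine ⟨⟨f, hf, h⟩, fun h' => hfe (key f hf ?_)⟩
    have h1 : s(u, w) = e.edge := h'
    exact h1 ▸ (Sym2.eq_iff.2 h : s(f.fst, f.snd) = s(u, w))
  · rintro ⟨⟨f, hf, h⟩, h'⟩
    refine ⟨f, ⟨hf, ?_⟩, h⟩
    rintro rfl
    apply h'
    exact (Sym2.eq_iff.2 h : s(f.fst, f.snd) = s(u, w)).symm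

theorem IsOrientedSpanningTree.fst_notMem_headSide (hT : IsOrientedSpanningTree T) {e : G.Dart}
    (he : e ∈ T) : e.fst ∉ headSide T e := by
  intro h
  have hadj : (underlyingGraph T).Adj e.fst e.snd := underlyingGraph_adj.2 ⟨e, he, by simp⟩
  have hb := isAcyclic_iff_forall_adj_isBridge.1 hT.1.2 hadj
  rw [isBridge_iff] at hb
  apply hb
  change (underlyingGraph (T \ {e})).Reachable e.snd e.fst at h
  rw [hT.underlyingGraph_diff he] at h
  exact h.symm

/-- Follow a walk from `u` to the tail of `e`: either it avoids `e`, or its part before the first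
use of `e` ends at one of the two endpoints. -/
theorem IsOrientedSpanningTree.mem_headSide_or (hT : IsOrientedSpanningTree T) (e : G.Dart)
    (u : V) : u ∈ headSide T e ∨ (underlyingGraph (T \ {e})).Reachable u e.fst := by
  obtain ⟨p⟩ := hT.1.1.preconnected u e.fst
  generalize hx : e.fst = x at p
  induction p with
  | nil => right; exact Reachable.refl _
  | @cons a b c hab p ih =>
    obtain ⟨f, hf, hfab⟩ := underlyingGraph_adj.1 hab
    by_cases hfe : f = e
    · subst hfe
      rcases hfab with ⟨rfl, rfl⟩ | ⟨rfl, rfl⟩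
      · right; rw [hx]
      · left; exact snd_mem_headSide _
    · have h1 : (underlyingGraph (T \ {e})).Adj a b := underlyingGraph_adj.2 ⟨f, ⟨hf, hfe⟩, hfab⟩
      rcases ih hx with h | h
      · left; exact Reachable.trans h h1.reachable.symm
      · right; exact h1.reachable.trans h

theorem IsOrientedSpanningTree.mem_edgesPointingAway (hT : IsOrientedSpanningTree T) {e : G.Dart}
    {v : V} : e ∈ edgesPointingAway T v ↔ e ∈ T ∧ v ∉ headSide T e := by
  refine and_congr_right fun he => ⟨fun h h' => hT.fst_notMem_headSide he (Reachable.trans h' h),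
    fun h => (hT.mem_headSide_or e v).resolve_left h⟩

theorem mem_headSide_iff_of_ne {e f : G.Dart} (hf : f ∈ T) (hfe : f ≠ e) :
    f.fst ∈ headSide T e ↔ f.snd ∈ headSide T e := by
  have h1 : (underlyingGraph (T \ {e})).Adj f.fst f.snd :=
    underlyingGraph_adj.2 ⟨f, ⟨hf, hfe⟩, by simp⟩
  exact ⟨fun h => Reachable.trans h h1.reachable, fun h => Reachable.trans h h1.reachable.symm⟩

theorem IsOrientedSpanningTree.ncard_add_one [Finite V] (hT : IsOrientedSpanningTree T) :
    T.ncard + 1 = Nat.card V := by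
  classical
  have := Fintype.ofFinite V
  have h := hT.1.card_edgeFinset
  rw [Nat.card_eq_fintype_card, ← h]
  congr 1
  rw [← Set.ncard_coe_finset, coe_edgeFinset, underlyingGraph, edgeSet_fromEdgeSet]
  have hd : Dart.edge '' T \ Sym2.diagSet = Dart.edge '' T := by
    refine sdiff_eq_left.2 (Set.disjoint_left.2 ?_)
    rintro _ ⟨e, he, rfl⟩ h
    exact G.not_isDiag_of_mem_edgeSet e.edge_mem (by simpa using h)
  rw [hd, Set.InjOn.ncard_image]
  intro f hf e he h
  rcases dart_edge_eq_iff _ _ |>.1 h with h | h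
  · exact h
  · exact absurd (h ▸ hf) (hT.2 e he)

end Combinatorics

/-! ### Cut forms as the dual basis of a tree, over any commutative ring -/

section Coordinates

variable {V : Type*} [Fintype V] {G : SimpleGraph V} {T : Set G.Dart} (R : Type*) [CommRing R]

open Classical in
/-- The linear form summing the coordinates over the head side of `e`. -/
noncomputable def cutForm (T : Set G.Dart) (e : G.Dart) : (V → R) →ₗ[R] R :=
  ∑ u with u ∈ headSide T e, LinearMap.proj u

/-- The vectors with coordinate sum zero. -/
def zeroSum (V : Type*) [Fintype V] : Submodule R (V → R) :=
  LinearMap.ker (∑ u : V, (LinearMap.proj u : (V → R) →ₗ[R] R))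

variable {R}

theorem mem_zeroSum {x : V → R} : x ∈ zeroSum R V ↔ ∑ u, x u = 0 := by
  simp [zeroSum, LinearMap.sum_apply]

open Classical in
theorem cutForm_apply (e : G.Dart) (x : V → R) :
    cutForm R T e x = ∑ u with u ∈ headSide T e, x u := by
  simp [cutForm, LinearMap.sum_apply]

variable [DecidableEq V]

variable (R) in
/-- The vector `1_h - 1_t` of an oriented edge over an arbitrary ring. -/
def dartVector (e : G.Dart) : V → R := Pi.single e.snd 1 - Pi.single e.fst 1

open Classical in
theorem cutForm_single (e : G.Dart) (v : V) :
    cutForm R T e (Pi.single v 1) = if v ∈ headSide T e then 1 else 0 := by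
  rw [cutForm_apply, Finset.sum_filter, Finset.sum_eq_single v] <;> simp +contextual

theorem dartVector_mem_zeroSum (e : G.Dart) : dartVector R e ∈ zeroSum R V := by
  simp [mem_zeroSum, dartVector]

theorem IsOrientedSpanningTree.cutForm_self (hT : IsOrientedSpanningTree T) {e : G.Dart}
    (he : e ∈ T) : cutForm R T e (dartVector R e) = 1 := by
  simp [dartVector, cutForm_single, snd_mem_headSide, hT.fst_notMem_headSide he]

theorem cutForm_of_ne {e f : G.Dart} (hf : f ∈ T) (hfe : f ≠ e) :
    cutForm R T e (dartVector R f) = 0 := by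
  have h := mem_headSide_iff_of_ne hf hfe
  by_cases h' : f.snd ∈ headSide T e
  · simp [dartVector, cutForm_single, h', h.2 h']
  · simp [dartVector, cutForm_single, h', mt h.1 h']

/-- Differences of basis vectors telescope along walks in the tree. Over `ℤ` this is the
unimodularity of the simplices. -/
theorem IsOrientedSpanningTree.zeroSum_le_span (hT : IsOrientedSpanningTree T) :
    zeroSum R V ≤ Submodule.span R (dartVector R '' T) := by
  have key : ∀ u w : V, (Pi.single u 1 - Pi.single w 1 : V → R) ∈
      Submodule.span R (dartVector R '' T) := by
    intro u w
    obtain ⟨p⟩ := hT.1.1.preconnected u w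
    induction p with
    | nil => simp
    | @cons a b c hab p ih =>
      obtain ⟨f, hf, hfab⟩ := underlyingGraph_adj.1 hab
      have h1 : dartVector R f ∈ Submodule.span R (dartVector R '' T) :=
        Submodule.subset_span ⟨f, hf, rfl⟩
      have h2 : (Pi.single a 1 - Pi.single b 1 : V → R) ∈
          Submodule.span R (dartVector R '' T) := by
        rcases hfab with ⟨rfl, rfl⟩ | ⟨rfl, rfl⟩
        · rw [← neg_sub]; exact neg_mem h1
        · exact h1
      simpa using add_mem h2 ih
  intro x hx
  obtain ⟨r⟩ := hT.1.1.nonempty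
  -- The total coefficient of the root `r` is the coordinate sum of `x`, which vanishes.
  have hx' : x = ∑ u, x u • (Pi.single u 1 - Pi.single r 1 : V → R) := by
    simp only [smul_sub, Finset.sum_sub_distrib, ← Finset.sum_smul, mem_zeroSum.1 hx, zero_smul,
      sub_zero]
    ext w
    simp [Finset.sum_apply, Pi.single_apply]
  rw [hx']
  exact sum_mem fun u _ => Submodule.smul_mem _ _ (key u r)

theorem IsOrientedSpanningTree.cutForm_sum [Fintype T] (hT : IsOrientedSpanningTree T)
    (c : T → R) (e : T) : cutForm R T e (∑ f : T, c f • dartVector R f.1) = c e := by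
  rw [map_sum, Finset.sum_eq_single e]
  · simp [hT.cutForm_self e.2]
  · intro f _ hfe
    rw [map_smul, cutForm_of_ne f.2 (fun h => hfe (Subtype.ext h)), smul_zero]
  · simp

theorem IsOrientedSpanningTree.sum_cutForm [Fintype T] (hT : IsOrientedSpanningTree T)
    {x : V → R} (hx : x ∈ zeroSum R V) : ∑ e : T, cutForm R T e x • dartVector R e.1 = x := by
  have h := hT.zeroSum_le_span hx
  rw [show dartVector R '' T = Set.range (fun e : T => dartVector R e.1) by
    rw [Set.image_eq_range]] at h
  obtain ⟨c, rfl⟩ := (Submodule.mem_span_range_iff_exists_fun R).1 h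
  simp only [hT.cutForm_sum]

theorem sum_smul_dartVector_mem_zeroSum [Fintype T] (c : T → R) :
    ∑ e : T, c e • dartVector R e.1 ∈ zeroSum R V :=
  sum_mem fun e _ => Submodule.smul_mem _ _ (dartVector_mem_zeroSum e.1)

end Coordinates

/-! ### The gauge of the polytope and the cones over the simplices -/

section Polytope

theorem intrinsicFrontier_eq_of_eq_affineSpan {E : Type*} [NormedAddCommGroup E] [NormedSpace ℝ E]
    {s : Set E} {A : AffineSubspace ℝ E}
    (hA : A = affineSpan ℝ s) :
    intrinsicFrontier ℝ s = (↑) '' frontier ((↑) ⁻¹' s : Set A) := by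
  subst hA
  rfl

variable {V : Type*} {G : SimpleGraph V} {T : Set G.Dart}

theorem IsOrientedSpanningTree.nonempty [Finite V] [Nontrivial V] (hT : IsOrientedSpanningTree T) :
    T.Nonempty := by
  have h := hT.ncard_add_one
  have h1 : 1 < Nat.card V := Finite.one_lt_card
  exact Set.nonempty_of_ncard_ne_zero (by omega)

theorem smul_edgeVector_mem [DecidableEq V] (e : G.Dart) {t : ℝ} (ht : |t| ≤ 1) :
    t • edgeVector e ∈ G.symmetricEdgePolytope := by
  have h1 : edgeVector e ∈ G.symmetricEdgePolytope := subset_convexHull _ _ ⟨e, rfl⟩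
  have h2 : -edgeVector e ∈ G.symmetricEdgePolytope :=
    subset_convexHull _ _ ⟨e.symm, by simp [edgeVector]⟩
  have h := convex_convexHull ℝ (Set.range (edgeVector (G := G))) h1 h2
    (a := (1 + t) / 2) (b := (1 - t) / 2) (by linarith [abs_le.1 ht]) (by linarith [abs_le.1 ht])
    (by ring)
  rwa [show ((1 + t) / 2) • edgeVector e + ((1 - t) / 2) • -edgeVector e = t • edgeVector e by
    module] at h

variable [Fintype V]

theorem continuous_cutForm (e : G.Dart) : Continuous (cutForm ℝ T e) :=
  LinearMap.continuous_of_finiteDimensional _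

variable [DecidableEq V]

theorem edgeVector_mem_zeroSum (e : G.Dart) : edgeVector e ∈ zeroSum ℝ V :=
  dartVector_mem_zeroSum e

theorem symmetricEdgePolytope_subset_zeroSum :
    G.symmetricEdgePolytope ⊆ (zeroSum ℝ V : Set (V → ℝ)) :=
  convexHull_min (Set.range_subset_iff.2 edgeVector_mem_zeroSum) (zeroSum ℝ V).convex

theorem IsOrientedSpanningTree.mem_rootPolytope [Fintype T] (hT : IsOrientedSpanningTree T)
    {x : V → ℝ} (hx : x ∈ zeroSum ℝ V) (h0 : ∀ e ∈ T, 0 ≤ cutForm ℝ T e x)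
    (h1 : ∑ e : T, cutForm ℝ T e x = 1) : x ∈ rootPolytope T := by
  rw [← hT.sum_cutForm hx]
  exact (convex_convexHull ℝ _).sum_mem (fun e _ => h0 e e.2) h1
    fun e _ => subset_convexHull _ _ ⟨e, e.2, rfl⟩

theorem IsOrientedSpanningTree.sum_cutForm_edgeVector [Fintype T]
    (hT : IsOrientedSpanningTree T) {f : G.Dart} (hf : f ∈ T) :
    ∑ e : T, cutForm ℝ T e (edgeVector f) = 1 := by
  rw [Finset.sum_eq_single ⟨f, hf⟩]
  · exact hT.cutForm_self hf
  · intro e _ he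
    exact cutForm_of_ne hf fun h => he (Subtype.ext h.symm)
  · simp

theorem IsOrientedSpanningTree.cutForm_nonneg_of_mem_rootPolytope
    (hT : IsOrientedSpanningTree T) {x : V → ℝ} (hx : x ∈ rootPolytope T) {e : G.Dart}
    (he : e ∈ T) : 0 ≤ cutForm ℝ T e x := by
  have h : rootPolytope T ⊆ {x | 0 ≤ cutForm ℝ T e x} := by
    refine convexHull_min ?_ (convex_halfSpace_ge (cutForm ℝ T e).isLinear 0)
    rintro _ ⟨f, hf, rfl⟩
    by_cases hfe : f = e
    · subst hfe
      exact (hT.cutForm_self (R := ℝ) he).ge.trans' zero_le_one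
    · exact (cutForm_of_ne (R := ℝ) hf hfe).ge
  exact h hx

/-- Points with positive coordinates lie in the relative interior of the simplex of the tree. -/
theorem IsOrientedSpanningTree.mem_intrinsicInterior [Fintype T]
    (hT : IsOrientedSpanningTree T) {x : V → ℝ} (hx : x ∈ zeroSum ℝ V)
    (h0 : ∀ e ∈ T, 0 < cutForm ℝ T e x) (h1 : ∑ e : T, cutForm ℝ T e x = 1) :
    x ∈ intrinsicInterior ℝ (rootPolytope T) := by
  have hxQ := hT.mem_rootPolytope hx (fun e he => (h0 e he).le) h1
  rw [_root_.mem_intrinsicInterior]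
  refine ⟨⟨x, subset_affineSpan ℝ _ hxQ⟩, ?_, rfl⟩
  rw [mem_interior_iff_mem_nhds]
  have hnhds : ∀ᶠ y : affineSpan ℝ (rootPolytope T) in
      nhds ⟨x, subset_affineSpan ℝ _ hxQ⟩, ∀ e : T, 0 < cutForm ℝ T e.1 (y : V → ℝ) := by
    rw [Filter.eventually_all]
    intro e
    exact ((continuous_cutForm e.1).comp continuous_subtype_val).continuousAt.eventually
      (lt_mem_nhds (h0 e e.2))
  filter_upwards [hnhds] with y hy
  have hspan : (affineSpan ℝ (rootPolytope T) : Set (V → ℝ)) ⊆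
      {y | y ∈ zeroSum ℝ V ∧ ∑ e : T, cutForm ℝ T e y = 1} := by
    rw [rootPolytope, affineSpan_convexHull]
    intro y hy
    refine affineSpan_induction
      (p := fun y => y ∈ zeroSum ℝ V ∧ ∑ e : T, cutForm ℝ T e y = 1) hy ?_ ?_
    · rintro _ ⟨f, hf, rfl⟩
      exact ⟨edgeVector_mem_zeroSum f, hT.sum_cutForm_edgeVector hf⟩
    · intro c u v w hu hv hw
      refine ⟨add_mem (Submodule.smul_mem _ _ (sub_mem hu.1 hv.1)) hw.1, ?_⟩
      simp only [vsub_eq_sub, vadd_eq_add, map_add, map_smul, map_sub, Finset.sum_add_distrib,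
        ← Finset.smul_sum, Finset.sum_sub_distrib, hu.2, hv.2, hw.2]
      simp
  exact hT.mem_rootPolytope (hspan y.2).1 (fun e he => (hy ⟨e, he⟩).le) (hspan y.2).2

variable (G) in
/-- The symmetric edge polytope as a subset of the space of vectors with coordinate sum zero. -/
def polytopeInZeroSum : Set (zeroSum ℝ V) := (↑) ⁻¹' G.symmetricEdgePolytope

theorem gauge_polytopeInZeroSum (x : zeroSum ℝ V) :
    gauge G.polytopeInZeroSum x = gauge G.symmetricEdgePolytope (x : V → ℝ) := by
  rw [gauge_def', gauge_def']
  rfl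

theorem convex_polytopeInZeroSum : Convex ℝ G.polytopeInZeroSum :=
  (convex_convexHull ℝ _).linear_preimage (zeroSum ℝ V).subtype

/-- A single tree suffices: a vector with small tree coordinates is the average of `|T|` points,
each lying on the segment between an edge vector and its negative. -/
theorem IsOrientedSpanningTree.polytopeInZeroSum_mem_nhds [Nontrivial V]
    (hT : IsOrientedSpanningTree T) : G.polytopeInZeroSum ∈ nhds 0 := by
  classical
  have := Fintype.ofFinite T
  have : Nonempty T := hT.nonempty.to_subtype
  have hd : (0 : ℝ) < Fintype.card T := Nat.cast_pos.2 Fintype.card_pos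
  have hnhds : ∀ᶠ y : zeroSum ℝ V in nhds 0, ∀ e : T,
      |Fintype.card T * cutForm ℝ T e.1 (y : V → ℝ)| < 1 := by
    rw [Filter.eventually_all]
    intro e
    have hc : Continuous fun y : zeroSum ℝ V => |Fintype.card T * cutForm ℝ T e.1 (y : V → ℝ)| :=
      (continuous_const.mul ((continuous_cutForm e.1).comp continuous_subtype_val)).abs
    exact hc.continuousAt.eventually (gt_mem_nhds (by simp))
  filter_upwards [hnhds] with y hy
  change (y : V → ℝ) ∈ G.symmetricEdgePolytope
  have h := (convex_convexHull ℝ (Set.range (edgeVector (G := G)))).sum_mem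
    (t := (Finset.univ : Finset T)) (w := fun _ => (Fintype.card T : ℝ)⁻¹)
    (z := fun e : T => (Fintype.card T * cutForm ℝ T e.1 (y : V → ℝ)) • edgeVector e.1)
    (fun _ _ => by positivity)
    (by rw [Finset.sum_const, Finset.card_univ, nsmul_eq_mul, mul_inv_cancel₀ hd.ne'])
    (fun e _ => smul_edgeVector_mem e.1 (hy e).le)
  refine (congrArg (· ∈ G.symmetricEdgePolytope)
    (Eq.trans (Finset.sum_congr rfl fun e _ => ?_) (hT.sum_cutForm y.2))).mp h
  rw [smul_smul, ← mul_assoc, inv_mul_cancel₀ hd.ne', one_mul]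
  rfl

theorem isVonNBounded_polytopeInZeroSum : Bornology.IsVonNBounded ℝ G.polytopeInZeroSum := by
  classical
  have hb : Bornology.IsBounded G.symmetricEdgePolytope :=
    isBounded_convexHull.2 (Set.finite_range _).isBounded
  exact NormedSpace.isVonNBounded_of_isBounded ℝ
    (isometry_subtype_coe.antilipschitz.isBounded_preimage hb)

/-- The polytope contains the origin and absorbs the zero-sum space, so every zero-sum vector lies
on a line through the origin and a point of the polytope. -/
theorem IsOrientedSpanningTree.affineSpan_symmetricEdgePolytope [Nontrivial V]
    (hT : IsOrientedSpanningTree T) :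
    (zeroSum ℝ V).toAffineSubspace = affineSpan ℝ G.symmetricEdgePolytope := by
  have hn := hT.polytopeInZeroSum_mem_nhds
  refine le_antisymm ?_ (affineSpan_le.2 symmetricEdgePolytope_subset_zeroSum)
  intro x hx
  obtain ⟨r, hr, hxr⟩ := (absorbent_nhds_zero hn).gauge_set_nonempty (x := ⟨x, hx⟩)
  obtain ⟨y, hy, hyx⟩ := hxr
  have h0' : (0 : zeroSum ℝ V) ∈ G.polytopeInZeroSum := mem_of_mem_nhds hn
  have h0 : (0 : V → ℝ) ∈ G.symmetricEdgePolytope := h0'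
  have h := AffineMap.lineMap_mem r (subset_affineSpan ℝ _ h0)
    (subset_affineSpan ℝ G.symmetricEdgePolytope hy)
  have hx' : r • (y : V → ℝ) = x := congrArg Subtype.val hyx
  simpa [AffineMap.lineMap_apply, hx'] using h

theorem IsOrientedSpanningTree.mem_intrinsicFrontier_iff [Nontrivial V]
    (hT : IsOrientedSpanningTree T) {x : V → ℝ} :
    x ∈ intrinsicFrontier ℝ G.symmetricEdgePolytope ↔
      x ∈ zeroSum ℝ V ∧ gauge G.symmetricEdgePolytope x = 1 := by
  rw [intrinsicFrontier_eq_of_eq_affineSpan hT.affineSpan_symmetricEdgePolytope]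
  have key : ∀ y : zeroSum ℝ V, gauge G.symmetricEdgePolytope (y : V → ℝ) = 1 ↔
      y ∈ frontier G.polytopeInZeroSum := fun y => by
    rw [← gauge_polytopeInZeroSum,
      gauge_eq_one_iff_mem_frontier convex_polytopeInZeroSum hT.polytopeInZeroSum_mem_nhds]
  constructor
  · rintro ⟨y, hy, rfl⟩
    exact ⟨y.2, (key y).2 hy⟩
  · rintro ⟨hx, h⟩
    exact ⟨⟨x, hx⟩, (key ⟨x, hx⟩).1 h, rfl⟩

theorem IsOrientedSpanningTree.gauge_pos [Nontrivial V] (hT : IsOrientedSpanningTree T)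
    {x : V → ℝ} (hx : x ∈ zeroSum ℝ V) (h0 : x ≠ 0) : 0 < gauge G.symmetricEdgePolytope x := by
  have h := (_root_.gauge_pos (x := (⟨x, hx⟩ : zeroSum ℝ V))
    (absorbent_nhds_zero hT.polytopeInZeroSum_mem_nhds)
    isVonNBounded_polytopeInZeroSum).2 (fun h => h0 (congrArg Subtype.val h))
  rwa [gauge_polytopeInZeroSum] at h

variable {𝒯 : Set (Set G.Dart)} [Nontrivial V]

/-- Dividing by the coordinate sum moves `x` into the simplex of `T`, hence into the boundary, where
the gauge is `1`; homogeneity does the rest. -/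
theorem IsDissectingTreeSet.gauge_eq_sum (h𝒯 : G.IsDissectingTreeSet 𝒯) (hT𝒯 : T ∈ 𝒯) [Fintype T]
    {x : V → ℝ} (hx : x ∈ zeroSum ℝ V) (h0 : ∀ e ∈ T, 0 ≤ cutForm ℝ T e x) :
    gauge G.symmetricEdgePolytope x = ∑ e : T, cutForm ℝ T e x := by
  have hT := h𝒯.isOrientedSpanningTree T hT𝒯
  have hs0 : 0 ≤ ∑ e : T, cutForm ℝ T e x := Finset.sum_nonneg fun e _ => h0 e e.2
  rcases hs0.eq_or_lt with hs | hs
  · have h : ∀ e : T, cutForm ℝ T e x = 0 := fun e =>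
      (Finset.sum_eq_zero_iff_of_nonneg fun e _ => h0 e.1 e.2).1 hs.symm e (Finset.mem_univ e)
    rw [← hs, ← hT.sum_cutForm hx]
    simp [h]
  · set s := ∑ e : T, cutForm ℝ T e x with hsdef
    have hmem : s⁻¹ • x ∈ rootPolytope T := by
      refine hT.mem_rootPolytope (Submodule.smul_mem _ _ hx) (fun e he => ?_) ?_
      · rw [map_smul]
        exact mul_nonneg (inv_nonneg.2 hs.le) (h0 e he)
      · simp only [map_smul, ← Finset.smul_sum]
        exact inv_mul_cancel₀ hs.ne'
    have hfr : s⁻¹ • x ∈ intrinsicFrontier ℝ G.symmetricEdgePolytope := by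
      rw [← h𝒯.iUnion_eq]
      exact Set.mem_biUnion hT𝒯 hmem
    have hg := (hT.mem_intrinsicFrontier_iff.1 hfr).2
    rw [gauge_smul_of_nonneg (inv_nonneg.2 hs.le), smul_eq_mul] at hg
    field_simp at hg
    exact hg

/-- The cones cover the space, because `x` can be scaled radially to the boundary, which the
simplices cover. -/
theorem IsDissectingTreeSet.exists_cutForm_nonneg (h𝒯 : G.IsDissectingTreeSet 𝒯)
    (hne : 𝒯.Nonempty) {x : V → ℝ} (hx : x ∈ zeroSum ℝ V) (hx0 : x ≠ 0) :
    ∃ T ∈ 𝒯, ∀ e ∈ T, 0 ≤ cutForm ℝ T e x := by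
  obtain ⟨T₀, hT₀⟩ := hne
  have hT := h𝒯.isOrientedSpanningTree T₀ hT₀
  have hg := hT.gauge_pos hx hx0
  have hfr : (gauge G.symmetricEdgePolytope x)⁻¹ • x ∈
      intrinsicFrontier ℝ G.symmetricEdgePolytope := by
    refine hT.mem_intrinsicFrontier_iff.2 ⟨Submodule.smul_mem _ _ hx, ?_⟩
    rw [gauge_smul_of_nonneg (inv_nonneg.2 hg.le), smul_eq_mul, inv_mul_cancel₀ hg.ne']
  rw [← h𝒯.iUnion_eq] at hfr
  obtain ⟨T, hT𝒯, hmem⟩ := Set.mem_iUnion₂.1 hfr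
  refine ⟨T, hT𝒯, fun e he => ?_⟩
  have h := (h𝒯.isOrientedSpanningTree T hT𝒯).cutForm_nonneg_of_mem_rootPolytope hmem he
  rw [map_smul, smul_eq_mul] at h
  exact nonneg_of_mul_nonneg_right h (inv_pos.2 hg)

/-- Open cones of distinct trees are disjoint: the gauge rescales `x` by the same factor for both
trees, putting it in both relative interiors. -/
theorem IsDissectingTreeSet.eq_of_cutForm_pos (h𝒯 : G.IsDissectingTreeSet 𝒯) {T' : Set G.Dart}
    (hT : T ∈ 𝒯) (hT' : T' ∈ 𝒯) {x : V → ℝ} (hx : x ∈ zeroSum ℝ V)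
    (h : ∀ e ∈ T, 0 < cutForm ℝ T e x) (h' : ∀ e ∈ T', 0 < cutForm ℝ T' e x) : T = T' := by
  have key : ∀ S ∈ 𝒯, (∀ e ∈ S, 0 < cutForm ℝ S e x) →
      (gauge G.symmetricEdgePolytope x)⁻¹ • x ∈ intrinsicInterior ℝ (rootPolytope S) := by
    intro S hS hpos
    classical
    have := Fintype.ofFinite S
    have hS' := h𝒯.isOrientedSpanningTree S hS
    have : Nonempty S := hS'.nonempty.to_subtype
    have hg := h𝒯.gauge_eq_sum hS hx fun e he => (hpos e he).le
    have hs : 0 < ∑ e : S, cutForm ℝ S e x :=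
      Finset.sum_pos (fun e _ => hpos e e.2) Finset.univ_nonempty
    rw [hg]
    refine hS'.mem_intrinsicInterior (Submodule.smul_mem _ _ hx) (fun e he => ?_) ?_
    · rw [map_smul]
      exact mul_pos (inv_pos.2 hs) (hpos e he)
    · simp only [map_smul, ← Finset.smul_sum]
      exact inv_mul_cancel₀ hs.ne'
  by_contra hne
  exact Set.disjoint_left.1 (h𝒯.interior_disjoint T hT T' hT' hne) (key T hT h) (key T' hT' h')

end Polytope

/-! ### Compositions and unitriangular systems -/

section Counting

/-- The number of ways to write `k` as `i` plus an ordered sum of `d` natural numbers. -/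
noncomputable def compositionCount (d k i : ℕ) : ℕ :=
  Nat.card {c : Fin d → ℕ // ∑ j, c j + i = k}

theorem finite_compositions (d k i : ℕ) : Finite {c : Fin d → ℕ // ∑ j, c j + i = k} := by
  refine Set.Finite.to_subtype ((Set.finite_Iic (fun _ => k : Fin d → ℕ)).subset fun c hc j => ?_)
  have h := Finset.single_le_sum (fun l _ => Nat.zero_le (c l)) (Finset.mem_univ j)
  have hc' : ∑ j, c j + i = k := hc
  show c j ≤ k
  omega

theorem compositionCount_of_lt {d k i : ℕ} (h : k < i) : compositionCount d k i = 0 := by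
  have : IsEmpty {c : Fin d → ℕ // ∑ j, c j + i = k} := ⟨fun c => by have := c.2; omega⟩
  exact Nat.card_of_isEmpty

theorem compositionCount_self (d k : ℕ) : compositionCount d k k = 1 := by
  rw [compositionCount, Nat.card_eq_one_iff_unique]
  refine ⟨⟨fun a b => Subtype.ext (funext fun j => ?_)⟩, ⟨⟨0, by simp⟩⟩⟩
  have ha : ∑ j, a.1 j = 0 := by have := a.2; omega
  have hb : ∑ j, b.1 j = 0 := by have := b.2; omega
  rw [Finset.sum_eq_zero_iff] at ha hb
  rw [ha j (Finset.mem_univ j), hb j (Finset.mem_univ j)]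

/-- A sum of lower unitriangular terms, grouped by the value of the parameter. -/
theorem sum_eq_sum_range_card_filter {γ : Type*} (r : Finset γ) (c : γ → ℕ) (f : ℕ → ℕ → ℕ)
    (hlt : ∀ k i, k < i → f k i = 0) (hself : ∀ k, f k k = 1) (k : ℕ) :
    ∑ x ∈ r, f k (c x) =
      ∑ i ∈ Finset.range k, (r.filter (c · = i)).card * f k i + (r.filter (c · = k)).card := by
  have h1 : ∑ x ∈ r, f k (c x) = ∑ x ∈ r with c x ∈ Finset.range (k + 1), f k (c x) := by
    rw [Finset.sum_filter]
    refine Finset.sum_congr rfl fun x _ => ?_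
    split_ifs with hx
    · rfl
    · exact hlt _ _ (by simpa using hx)
  rw [h1, ← Finset.sum_fiberwise_of_maps_to (g := c) (t := Finset.range (k + 1))
    (fun x hx => (Finset.mem_filter.1 hx).2)]
  have h2 : ∀ i ∈ Finset.range (k + 1), ∑ x ∈ r.filter (c · ∈ Finset.range (k + 1)) with c x = i,
      f k (c x) = (r.filter (c · = i)).card * f k i := by
    intro i hi
    rw [Finset.filter_filter, Finset.sum_congr rfl
      (g := fun _ => f k i) (fun x hx => by rw [(Finset.mem_filter.1 hx).2.2]),
      Finset.sum_const, smul_eq_mul]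
    congr 2
    ext x
    simp only [Finset.mem_filter, and_congr_right_iff, and_iff_right_iff_imp]
    rintro _ rfl
    exact hi
  rw [Finset.sum_congr rfl h2, Finset.sum_range_succ, hself, mul_one]

/-- A unitriangular system determines the sizes of the fibres of a function on a finite set. -/
theorem card_filter_eq_of_sum_eq {α β : Type*} (s : Finset α) (t : Finset β) (a : α → ℕ)
    (b : β → ℕ) (f : ℕ → ℕ → ℕ) (hlt : ∀ k i, k < i → f k i = 0) (hself : ∀ k, f k k = 1)
    (h : ∀ k, ∑ x ∈ s, f k (a x) = ∑ y ∈ t, f k (b y)) (m : ℕ) :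
    (s.filter (a · = m)).card = (t.filter (b · = m)).card := by
  induction m using Nat.strong_induction_on with
  | _ m ih =>
    have hm := h m
    have hs := sum_eq_sum_range_card_filter s a f hlt hself m
    have ht := sum_eq_sum_range_card_filter t b f hlt hself m
    have hst : ∑ i ∈ Finset.range m, (s.filter (a · = i)).card * f m i =
        ∑ i ∈ Finset.range m, (t.filter (b · = i)).card * f m i :=
      Finset.sum_congr rfl fun i hi => by rw [ih i (Finset.mem_range.1 hi)]
    omega

end Counting

/-! ### Lattice points in half-open cones -/

section LatticePoints

variable {V : Type*} {G : SimpleGraph V} {T : Set G.Dart}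

open Classical in
/-- The indicator of the edge `e` of `T` pointing away from `v`. -/
noncomputable def awayIndicator (T : Set G.Dart) (v : V) (e : G.Dart) : ℕ :=
  if v ∈ headSide T e then 0 else 1

theorem IsOrientedSpanningTree.sum_awayIndicator [Fintype T] (hT : IsOrientedSpanningTree T)
    (v : V) : ∑ e : T, awayIndicator T v e = (edgesPointingAway T v).ncard := by
  classical
  have h : edgesPointingAway T v = Subtype.val '' {e : T | v ∉ headSide T e} := by
    ext e
    rw [hT.mem_edgesPointingAway]
    simp [and_comm]
  rw [h, Set.ncard_image_of_injective _ Subtype.val_injective, Set.ncard_eq_toFinset_card',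
    Set.toFinset_ofPred, Finset.card_filter]
  refine Finset.sum_congr rfl fun e _ => ?_
  by_cases hv : v ∈ headSide T e <;> simp [awayIndicator, hv]

variable [Fintype V]

/-- An integer vector viewed as a real one. -/
def realVector (z : V → ℤ) : V → ℝ := fun u => z u

theorem realVector_mem_zeroSum {z : V → ℤ} (hz : z ∈ zeroSum ℤ V) :
    realVector z ∈ zeroSum ℝ V := by
  rw [mem_zeroSum] at hz ⊢
  simp only [realVector]
  exact_mod_cast hz

theorem cutForm_realVector (e : G.Dart) (z : V → ℤ) :
    cutForm ℝ T e (realVector z) = cutForm ℤ T e z := by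
  simp [cutForm_apply, realVector]

variable [DecidableEq V]

/-- The vector obtained from `z` by adding `1` at `v` and then subtracting the barycentre. -/
noncomputable def shiftedVector (v : V) (z : V → ℤ) : V → ℝ :=
  realVector z + Pi.single v 1 - fun _ => (Fintype.card V : ℝ)⁻¹

theorem shiftedVector_mem_zeroSum (v : V) {z : V → ℤ} (hz : z ∈ zeroSum ℤ V) :
    shiftedVector v z ∈ zeroSum ℝ V := by
  have h := mem_zeroSum.1 (realVector_mem_zeroSum hz)
  have hn : (Fintype.card V : ℝ) ≠ 0 :=
    Nat.cast_ne_zero.2 (Fintype.card_pos_iff.2 ⟨v⟩).ne'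
  rw [mem_zeroSum]
  simp [shiftedVector, Finset.sum_add_distrib, h, hn]

/-- A coordinate away from `v` is an integer minus `1/n` with `n ≥ 2`. -/
theorem shiftedVector_ne_zero [Nontrivial V] (v : V) (z : V → ℤ) : shiftedVector v z ≠ 0 := by
  intro h
  obtain ⟨u, hu⟩ := exists_ne v
  have h1 := congrFun h u
  simp only [shiftedVector, realVector, Pi.sub_apply, Pi.add_apply, Pi.single_eq_of_ne hu,
    Pi.zero_apply, add_zero, sub_eq_zero] at h1
  have hn : (1 : ℝ) < Fintype.card V := by exact_mod_cast Fintype.one_lt_card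
  have h2 : (0 : ℝ) < z u := by rw [h1]; positivity
  have h3 : (z u : ℝ) < 1 := by rw [h1]; exact inv_lt_one_of_one_lt₀ hn
  have h4 : 0 < z u := by exact_mod_cast h2
  have h5 : z u < 1 := by exact_mod_cast h3
  omega

/-- The key genericity: `r` does not depend on `z` and lies strictly between `0` and `1`, so for the
shifted vector "nonnegative" and "positive" both amount to an integer inequality on `z`. -/
theorem IsOrientedSpanningTree.exists_cutForm_shiftedVector (hT : IsOrientedSpanningTree T)
    {e : G.Dart} (he : e ∈ T) (v : V) : ∃ r : ℝ, 0 < r ∧ r < 1 ∧ ∀ z : V → ℤ,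
      cutForm ℝ T e (shiftedVector v z) = (cutForm ℤ T e z : ℤ) - awayIndicator T v e + r := by
  classical
  have hn : (0 : ℝ) < Fintype.card V := Nat.cast_pos.2 (Fintype.card_pos_iff.2 ⟨v⟩)
  have hlt : ((Finset.univ.filter (· ∈ headSide T e)).card : ℝ) < Fintype.card V := by
    refine Nat.cast_lt.2 (Finset.card_lt_univ_of_notMem (x := e.fst) ?_)
    simpa using hT.fst_notMem_headSide he
  have hpos : (0 : ℝ) < (Finset.univ.filter (· ∈ headSide T e)).card :=
    Nat.cast_pos.2 (Finset.card_pos.2 ⟨e.snd, by simpa using snd_mem_headSide e⟩)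
  have hq := div_pos hpos hn
  have hq1 := (div_lt_one hn).2 hlt
  -- The barycentre contributes `-|H|/n`, where the head side `H` is nonempty and misses the tail.
  -- The vector `1_v` contributes `1` minus the indicator, which supplies the summand `1`.
  refine ⟨1 - (Finset.univ.filter (· ∈ headSide T e)).card / Fintype.card V, by linarith,
    by linarith, fun z => ?_⟩
  have hc : cutForm ℝ T e (fun _ => (Fintype.card V : ℝ)⁻¹) =
      (Finset.univ.filter (· ∈ headSide T e)).card / Fintype.card V := by
    rw [cutForm_apply, Finset.sum_const, nsmul_eq_mul, div_eq_mul_inv]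
  rw [shiftedVector, map_sub, map_add, cutForm_realVector, hc, cutForm_single, awayIndicator]
  split_ifs <;> push_cast <;> ring

theorem IsOrientedSpanningTree.awayIndicator_le_of_nonneg (hT : IsOrientedSpanningTree T)
    {e : G.Dart} (he : e ∈ T) {v : V} {z : V → ℤ}
    (h : 0 ≤ cutForm ℝ T e (shiftedVector v z)) : (awayIndicator T v e : ℤ) ≤ cutForm ℤ T e z := by
  obtain ⟨r, -, hr1, hr⟩ := hT.exists_cutForm_shiftedVector he v
  rw [hr] at h
  have h1 : ((awayIndicator T v e : ℤ) : ℝ) < ((cutForm ℤ T e z + 1 : ℤ) : ℝ) := by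
    push_cast
    linarith
  exact Int.lt_add_one_iff.1 (Int.cast_lt.1 h1)

theorem IsOrientedSpanningTree.pos_of_awayIndicator_le (hT : IsOrientedSpanningTree T)
    {e : G.Dart} (he : e ∈ T) {v : V} {z : V → ℤ}
    (h : (awayIndicator T v e : ℤ) ≤ cutForm ℤ T e z) :
    0 < cutForm ℝ T e (shiftedVector v z) := by
  obtain ⟨r, hr0, -, hr⟩ := hT.exists_cutForm_shiftedVector he v
  rw [hr]
  have h1 : ((awayIndicator T v e : ℤ) : ℝ) ≤ ((cutForm ℤ T e z : ℤ) : ℝ) := Int.cast_le.2 h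
  push_cast at h1
  linarith

variable (G) in
/-- The integer points with coordinate sum zero on the `k`-th dilate of the boundary of the
symmetric edge polytope. -/
abbrev HeightPoints (k : ℕ) : Type _ :=
  {z : V → ℤ // z ∈ zeroSum ℤ V ∧ gauge G.symmetricEdgePolytope (realVector z) = k}

/-- The points of `HeightPoints` in the cone over the simplex of `T`, with the facets visible
from `v` removed. -/
abbrev HalfOpenConePoints (T : Set G.Dart) (v : V) (k : ℕ) : Type _ :=
  {z : HeightPoints G k // ∀ e ∈ T, (awayIndicator T v e : ℤ) ≤ cutForm ℤ T e z.1}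

variable {𝒯 : Set (Set G.Dart)} [Nontrivial V]

theorem IsDissectingTreeSet.gauge_eq_natCast_iff (h𝒯 : G.IsDissectingTreeSet 𝒯) (hT𝒯 : T ∈ 𝒯)
    [Fintype T] {z : V → ℤ} (hz : z ∈ zeroSum ℤ V) (h0 : ∀ e ∈ T, 0 ≤ cutForm ℤ T e z) (k : ℕ) :
    gauge G.symmetricEdgePolytope (realVector z) = k ↔ ∑ e : T, cutForm ℤ T e z = k := by
  rw [h𝒯.gauge_eq_sum hT𝒯 (realVector_mem_zeroSum hz) fun e he => by
    rw [cutForm_realVector]; exact_mod_cast h0 e he]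
  simp only [cutForm_realVector]
  exact_mod_cast Iff.rfl

/-- The points of a half-open cone correspond to their coordinates, shifted to be arbitrary
natural numbers. -/
noncomputable def IsDissectingTreeSet.halfOpenConeEquiv (h𝒯 : G.IsDissectingTreeSet 𝒯)
    (hT𝒯 : T ∈ 𝒯) [Fintype T] (v : V) (k : ℕ) :
    HalfOpenConePoints T v k ≃
      {c : T → ℕ // ∑ e, c e + (edgesPointingAway T v).ncard = k} where
  -- No truncation occurs in `toNat`: the half-open condition makes each difference nonnegative.
  toFun z := ⟨fun e => (cutForm ℤ T e z.1.1 - awayIndicator T v e).toNat, by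
    have hT := h𝒯.isOrientedSpanningTree T hT𝒯
    have h := (h𝒯.gauge_eq_natCast_iff hT𝒯 z.1.2.1
      (fun e he => (z.2 e he).trans' (Int.natCast_nonneg _)) k).1 z.1.2.2
    rw [← hT.sum_awayIndicator, ← Finset.sum_add_distrib]
    zify
    rw [← h]
    refine Finset.sum_congr rfl fun e _ => ?_
    have := z.2 e e.2
    omega⟩
  invFun c := ⟨⟨∑ e : T, ((c.1 e + awayIndicator T v e : ℕ) : ℤ) • dartVector ℤ e.1,
    sum_smul_dartVector_mem_zeroSum _, by
      have hT := h𝒯.isOrientedSpanningTree T hT𝒯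
      have hcut := hT.cutForm_sum (R := ℤ) fun e : T => ((c.1 e + awayIndicator T v e : ℕ) : ℤ)
      refine (h𝒯.gauge_eq_natCast_iff hT𝒯 (sum_smul_dartVector_mem_zeroSum _)
        (fun e he => ?_) k).2 ?_
      · rw [hcut ⟨e, he⟩]
        exact Int.natCast_nonneg _
      · simp only [hcut]
        rw [← Nat.cast_sum, Finset.sum_add_distrib, hT.sum_awayIndicator, c.2]⟩, fun e he => by
      have hT := h𝒯.isOrientedSpanningTree T hT𝒯
      rw [hT.cutForm_sum (R := ℤ) _ ⟨e, he⟩]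
      push_cast
      omega⟩
  left_inv z := by
    have hT := h𝒯.isOrientedSpanningTree T hT𝒯
    refine Subtype.ext (Subtype.ext ?_)
    refine Eq.trans (Finset.sum_congr rfl fun e _ => ?_) (hT.sum_cutForm z.1.2.1)
    congr 1
    have := z.2 e e.2
    push_cast
    omega
  right_inv c := by
    have hT := h𝒯.isOrientedSpanningTree T hT𝒯
    refine Subtype.ext (funext fun e => ?_)
    simp only [hT.cutForm_sum (R := ℤ)]
    omega

theorem IsDissectingTreeSet.card_halfOpenConePoints (h𝒯 : G.IsDissectingTreeSet 𝒯)
    (hT𝒯 : T ∈ 𝒯) (v : V) (k : ℕ) :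
    Finite (HalfOpenConePoints T v k) ∧ Nat.card (HalfOpenConePoints T v k) =
      compositionCount (Nat.card V - 1) k (edgesPointingAway T v).ncard := by
  classical
  have := Fintype.ofFinite T
  have hd : Nat.card T = Nat.card V - 1 := by
    rw [← (h𝒯.isOrientedSpanningTree T hT𝒯).ncard_add_one]
    rfl
  let φ : T ≃ Fin (Nat.card V - 1) := Finite.equivFinOfCardEq hd
  let ψ : {c : T → ℕ // ∑ e, c e + (edgesPointingAway T v).ncard = k} ≃
      {c : Fin (Nat.card V - 1) → ℕ // ∑ j, c j + (edgesPointingAway T v).ncard = k} :=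
    (φ.arrowCongr (Equiv.refl ℕ)).subtypeEquiv fun c => by
      simp [Equiv.arrowCongr, Equiv.sum_comp φ.symm c]
  have := finite_compositions (Nat.card V - 1) k (edgesPointingAway T v).ncard
  let χ := (h𝒯.halfOpenConeEquiv hT𝒯 v k).trans ψ
  exact ⟨Finite.of_equiv _ χ.symm, Nat.card_congr χ⟩

/-- The half-open cones partition the points: disjointness and covering are those of the cones,
applied to the shifted vectors. -/
theorem IsDissectingTreeSet.card_heightPoints (h𝒯 : G.IsDissectingTreeSet 𝒯)
    (hne : 𝒯.Nonempty) [Fintype 𝒯] (v : V) (k : ℕ) :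
    Nat.card (HeightPoints G k) = ∑ T : 𝒯,
      compositionCount (Nat.card V - 1) k (edgesPointingAway T.1 v).ncard := by
  let F : (Σ T : 𝒯, HalfOpenConePoints T.1 v k) → HeightPoints G k := fun p => p.2.1
  have hF : Function.Bijective F := by
    constructor
    · rintro ⟨⟨T, hT⟩, z, hz⟩ ⟨⟨T', hT'⟩, z', hz'⟩ h
      obtain rfl : z = z' := h
      have hTo := h𝒯.isOrientedSpanningTree T hT
      have hTo' := h𝒯.isOrientedSpanningTree T' hT'
      obtain rfl : T = T' := h𝒯.eq_of_cutForm_pos hT hT' (shiftedVector_mem_zeroSum v z.2.1)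
        (fun e he => hTo.pos_of_awayIndicator_le he (hz e he))
        (fun e he => hTo'.pos_of_awayIndicator_le he (hz' e he))
      rfl
    · intro z
      obtain ⟨T, hT, h⟩ := h𝒯.exists_cutForm_nonneg hne (shiftedVector_mem_zeroSum v z.2.1)
        (shiftedVector_ne_zero v z.1)
      exact ⟨⟨⟨T, hT⟩, z, fun e he =>
        (h𝒯.isOrientedSpanningTree T hT).awayIndicator_le_of_nonneg he (h e he)⟩, rfl⟩
  have hfin (T : 𝒯) := (h𝒯.card_halfOpenConePoints T.2 v k).1
  rw [← Nat.card_congr (Equiv.ofBijective F hF), Nat.card_sigma]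
  exact Finset.sum_congr rfl fun T _ => (h𝒯.card_halfOpenConePoints T.2 v k).2

/-- Both families have the same boundary as their union, and an edge vector of a tree lies on it.
This isolates the degenerate case in which there is no tree to provide coordinates. -/
theorem IsDissectingTreeSet.nonempty_of_nonempty (h𝒯 : G.IsDissectingTreeSet 𝒯)
    (hne : 𝒯.Nonempty) {𝒯' : Set (Set G.Dart)} (h𝒯' : G.IsDissectingTreeSet 𝒯') :
    𝒯'.Nonempty := by
  obtain ⟨T, hT⟩ := hne
  obtain ⟨e, he⟩ := (h𝒯.isOrientedSpanningTree T hT).nonempty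
  have h : edgeVector e ∈ ⋃ T ∈ 𝒯', rootPolytope T := by
    rw [h𝒯'.iUnion_eq, ← h𝒯.iUnion_eq]
    exact Set.mem_biUnion hT (subset_convexHull ℝ _ ⟨e, he, rfl⟩)
  obtain ⟨T', hT', -⟩ := Set.mem_iUnion₂.1 h
  exact ⟨T', hT'⟩

end LatticePoints

end SimpleGraph

/-! ### Comparison of two dissecting tree sets -/

theorem mainTheorem5 {V : Type*} [Finite V] [DecidableEq V] [Nontrivial V] (G : SimpleGraph V)
    (𝒯₁ 𝒯₂ : Set (Set G.Dart)) (h₁ : G.IsDissectingTreeSet 𝒯₁) (h₂ : G.IsDissectingTreeSet 𝒯₂)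
    (v₁ v₂ : V) (i : ℕ) :
    {T | T ∈ 𝒯₁ ∧ (SimpleGraph.edgesPointingAway T v₁).ncard = i}.ncard =
      {T | T ∈ 𝒯₂ ∧ (SimpleGraph.edgesPointingAway T v₂).ncard = i}.ncard := by
  classical
  have := Fintype.ofFinite V
  rcases 𝒯₁.eq_empty_or_nonempty with rfl | hne
  · have h : 𝒯₂ = ∅ := by
      by_contra h
      exact Set.not_nonempty_empty (h₂.nonempty_of_nonempty (Set.nonempty_iff_ne_empty.2 h) h₁)
    simp [h]
  have := Fintype.ofFinite 𝒯₁
  have := Fintype.ofFinite 𝒯₂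
  have count : ∀ (𝒯 : Set (Set G.Dart)) (v : V) [Fintype 𝒯],
      {T | T ∈ 𝒯 ∧ (SimpleGraph.edgesPointingAway T v).ncard = i}.ncard =
        (Finset.univ.filter fun T : 𝒯 =>
          (SimpleGraph.edgesPointingAway T.1 v).ncard = i).card := by
    intro 𝒯 v _
    rw [← Set.ncard_coe_finset, ← Set.ncard_image_of_injective _ Subtype.val_injective]
    congr 1
    ext T
    simp [and_comm]
  rw [count 𝒯₁ v₁, count 𝒯₂ v₂]
  -- For each `k`, both sums of composition counts equal the number of height points of `G`, in
  -- which neither tree set nor vertex occurs.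
  refine SimpleGraph.card_filter_eq_of_sum_eq _ _ _ _
    (SimpleGraph.compositionCount (Nat.card V - 1))
    (fun _ _ => SimpleGraph.compositionCount_of_lt) (SimpleGraph.compositionCount_self _)
    (fun k => ?_) i
  rw [← h₁.card_heightPoints hne v₁ k, ← h₂.card_heightPoints (h₁.nonempty_of_nonempty hne h₂) v₂ k]
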